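/- Let $G$ be a finite simple connected graph of order $n$ with minimum degree $\delta$, and let $k$ be an integer with $\delta \ge k \ge 3$. Let $\rho(G)$ be the largest eigenvalue of the adjacency matrix of $G$, and let $\kappa(G)$ be the vertex-connectivity of $G$, i.e. the minimum number of vertices whose removal disconnects $G$ if $G$ is not complete, and $n-1$ if $G$ is complete. If $$n \ge \tfrac12(\delta-k+2)(k^2-2k+7) \quad\text{and}\quad \rho(G) \ge n-\delta+k-3,$$ then $\kappa(G) \ge k$, unless $G = K_{k-1}\vee (K_{\delta-k+2}\cup K_{n-\delta-1})$ (up to isomorphism). Here $K_r$ is the complete graph of order $r$, $\cup$ denotes disjoint union, and $G_1\vee G_2$ is obtained from $G_1\cup G_2$ by joining every vertex of $G_1$ to every vertex of $G_2$. -/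

import Mathlib

namespace ConnSpec

/-- The spectral radius `ρ(G)` of a finite simple graph: the largest (real) eigenvalue of its
adjacency matrix. The set of eigenvalues is finite, and it is nonempty as soon as `G` has a vertex,
since the adjacency matrix is real symmetric; so the supremum is a maximum. -/
noncomputable def rho {V : Type*} [Fintype V] [DecidableEq V] (G : SimpleGraph V)
    [DecidableRel G.Adj] : ℝ :=
  sSup {μ : ℝ | Module.End.HasEigenvalue (Matrix.toLin' (G.adjMatrix ℝ)) μ}

/-- `S` is a vertex-cut of `G`: removing the vertices of `S` leaves a disconnected graph, that is,
two of the remaining vertices are not joined by a path avoiding `S`. -/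
def IsVertexCut {V : Type*} (G : SimpleGraph V) (S : Finset V) : Prop :=
  ¬ (G.induce {v : V | v ∉ S}).Preconnected

open Classical in
/-- The vertex-connectivity `κ(G)` of a (connected) finite graph: `n - 1` for the complete graph of
order `n`, and otherwise the minimum cardinality of a vertex-cut. A graph that is not complete
has a vertex-cut (all vertices but two nonadjacent ones), so the infimum is attained. -/
noncomputable def kappa {V : Type*} [Fintype V] (G : SimpleGraph V) : ℕ :=
  if G = ⊤ then Fintype.card V - 1
  else sInf {c : ℕ | ∃ S : Finset V, IsVertexCut G S ∧ S.card = c}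

/-- The join `G₁ ∨ G₂`: the disjoint union of the two graphs, together with all edges between a
vertex of `G₁` and a vertex of `G₂`. -/
def join {V W : Type*} (G : SimpleGraph V) (H : SimpleGraph W) : SimpleGraph (V ⊕ W) :=
  (G ⊕g H) ⊔ completeBipartiteGraph V W

/-- The graph `K_a ∨ (K_b ∪ K_c)`. -/
def joinOfCompletes (a b c : ℕ) : SimpleGraph (Fin a ⊕ (Fin b ⊕ Fin c)) :=
  join (⊤ : SimpleGraph (Fin a)) ((⊤ : SimpleGraph (Fin b)) ⊕g (⊤ : SimpleGraph (Fin c)))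

end ConnSpec

/-! Suppose κ(G) < k. A smallest cut can be enlarged to a set S of k - 1 vertices that separates a
side A from the rest B, with |A| ≤ |B|. Put t = δ - k + 2. A vertex of A has all its neighbours in A
∪ S, so |A| ≥ t, and the spectral threshold is n - t - 1.

A positive vector x with (adjacency matrix)·x < l·x entrywise forces ρ < l (`rho_lt_of_weights`).
Taking l = n - t - 1, such an x is built in two cases: when |A| > t (`rho_lt_of_large_side`), and
when |A| = t but two vertices outside A are nonadjacent (`rho_lt_of_missing_edge`). Hence |A| = t
and the complement of A is a clique. The degree bound then joins each vertex of A to all of A ∪ S,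
which leaves only the exceptional graph. -/

open Finset in
/-- A positive vector that is strictly superharmonic with factor `l` bounds the spectral radius. -/
theorem rho_lt_of_weights {V : Type*} [Fintype V] [DecidableEq V] [Nonempty V]
    (G : SimpleGraph V) [DecidableRel G.Adj] (x : V → ℝ) (l : ℝ) (hx : ∀ v, 0 < x v)
    (h : ∀ v, ∑ w ∈ G.neighborFinset v, x w < l * x v) : ConnSpec.rho G < l := by
  have hl : 0 < l := by
    obtain ⟨v⟩ := ‹Nonempty V›
    have h0 : 0 ≤ ∑ w ∈ G.neighborFinset v, x w := sum_nonneg fun w _ => (hx w).le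
    exact pos_of_mul_pos_left (h0.trans_lt (h v)) (hx v).le
  have key : ∀ μ, Module.End.HasEigenvalue (Matrix.toLin' (G.adjMatrix ℝ)) μ → μ < l := by
    intro μ hμ
    obtain ⟨y, hy⟩ := hμ.exists_hasEigenvector
    -- Evaluate the eigenvalue equation where |y|/x is largest; there the row inequality for x
    -- dominates the one for |y|.
    obtain ⟨i, -, hi⟩ := exists_max_image univ (fun v => |y v| / x v) univ_nonempty
    have hle : ∀ w, |y w| ≤ |y i| / x i * x w := fun w =>
      (div_le_iff₀ (hx w)).1 (hi w (mem_univ w))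
    have hyi : 0 < |y i| := by
      rcases (abs_nonneg (y i)).lt_or_eq with h1 | h1
      · exact h1
      · exfalso
        apply hy.2
        ext w
        have := hle w
        rw [← h1] at this
        simpa using this
    have heq : ∑ w ∈ G.neighborFinset i, y w = μ * y i := by
      have := congrFun hy.apply_eq_smul i
      simpa [Matrix.toLin'_apply, SimpleGraph.adjMatrix_mulVec_apply] using this
    have hc : 0 < |y i| / x i := div_pos hyi (hx i)
    have : μ * |y i| < l * |y i| := calc
      μ * |y i| ≤ |μ * y i| := by
        rw [abs_mul]; gcongr; exact le_abs_self μ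
      _ = |∑ w ∈ G.neighborFinset i, y w| := by rw [heq]
      _ ≤ ∑ w ∈ G.neighborFinset i, |y w| := abs_sum_le_sum_abs _ _
      _ ≤ ∑ w ∈ G.neighborFinset i, |y i| / x i * x w := sum_le_sum fun w _ => hle w
      _ = |y i| / x i * ∑ w ∈ G.neighborFinset i, x w := by rw [mul_sum]
      _ < |y i| / x i * (l * x i) := by gcongr; exact h i
      _ = l * |y i| := by field_simp [(hx i).ne']
    exact lt_of_mul_lt_mul_right this hyi.le
  unfold ConnSpec.rho
  rcases Set.eq_empty_or_nonempty
    {μ : ℝ | Module.End.HasEigenvalue (Matrix.toLin' (G.adjMatrix ℝ)) μ} with h0 | h0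
  · rw [h0, Real.sSup_empty]; exact hl
  · exact key _ (h0.csSup_mem (Module.End.finite_hasEigenvalue _))

/-! ### Choice of the weights -/

/-- Weights refuting a large spectral radius when the small side is too large. -/
theorem exists_weights_of_lt {p t a b : ℝ} (hp : 2 ≤ p) (ht : 2 ≤ t) (hta : t + 1 ≤ a)
    (hab : a ≤ b) (hn : t * (p ^ 2 + 6) ≤ 2 * (a + b + p)) :
    ∃ s α : ℝ, 0 < s ∧ 0 < α ∧
      p * s + b - 1 < a + b + p - t - 1 ∧
      a * α + p * s + b - s < (a + b + p - t - 1) * s ∧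
      a * α - α + p * s < (a + b + p - t - 1) * α := by
  have hq : 0 < b + p - t := by linarith
  -- This is what remains of the three row inequalities after eliminating α, then s, and cancelling
  -- a - t + p against b * p.
  have main : a * (a - t + p) * p < (a - t) * (a + b + p - t) * (b + p - t) := by
    obtain ⟨d, rfl⟩ : ∃ d, a = t + d := ⟨a - t, by ring⟩
    obtain ⟨e, rfl⟩ : ∃ e, b = t + d + e := ⟨b - (t + d), by ring⟩
    have hd : 1 ≤ d := by linarith
    have he : 0 ≤ e := by linarith
    have h1 : p * (t + d + p * (t + 1)) < (t + 2 * d + e + p) * (d + e + p) := by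
      have hX : 4 * p ≤ t * p ^ 2 := by
        nlinarith [mul_nonneg (sub_nonneg.2 ht) (sq_nonneg p), mul_nonneg (sub_nonneg.2 hp) (sub_nonneg.2 hp)]
      have e1 : 0 ≤ (t - 2) * (d + e) := mul_nonneg (by linarith) (by linarith)
      have e2 : 0 ≤ (d - 1) * d := mul_nonneg (by linarith) (by linarith)
      have e3 : 0 ≤ (p - 2) * (d + e) := mul_nonneg (by linarith) (by linarith)
      have e4 : 0 ≤ d * e := mul_nonneg (by linarith) he
      nlinarith [sq_nonneg e]
    have h2 : (t + d) * (d + p) ≤ d * (t + d + p * (t + 1)) := by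
      nlinarith [mul_nonneg (mul_nonneg (sub_nonneg.2 hd) (by linarith : 0 ≤ t)) (by linarith : 0 ≤ p)]
    calc _ = (t + d) * (d + p) * p := by ring
      _ ≤ d * (t + d + p * (t + 1)) * p := by gcongr
      _ = d * (p * (t + d + p * (t + 1))) := by ring
      _ < d * ((t + 2 * d + e + p) * (d + e + p)) := by gcongr
      _ = _ := by ring
  have hc : 0 < (a - t + b) * (b + p - t) - a * p := by
    by_contra! hc
    have e1 := mul_le_mul_of_nonneg_right hc (show 0 ≤ a - t + p by linarith)
    have e2 : 0 < b * p * (b + p - t) := by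
      have : 0 < b := by linarith
      positivity
    nlinarith
  obtain ⟨s, hs1, hs2⟩ : ∃ s : ℝ, b * (b + p - t) < s * ((a - t + b) * (b + p - t) - a * p) ∧
      p * s < a - t + p := by
    obtain ⟨s, h1, h2⟩ := exists_between
      (show b * (b + p - t) / ((a - t + b) * (b + p - t) - a * p) < (a - t + p) / p by
        rw [div_lt_div_iff₀ hc (by linarith)]
        nlinarith)
    refine ⟨s, (div_lt_iff₀ hc).1 h1, ?_⟩
    rw [lt_div_iff₀ (by linarith)] at h2
    linarith
  have hs : 0 < s := by
    by_contra! hs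
    have e1 : 0 < b * (b + p - t) := mul_pos (by linarith) hq
    nlinarith [mul_nonneg (neg_nonneg.2 hs) hc.le]
  obtain ⟨α, h1, h2⟩ := exists_between
    (show p * s / (b + p - t) < ((a - t + b) * s - b) / a by
      rw [div_lt_div_iff₀ hq (by linarith)]
      nlinarith)
  have hα : 0 < α := lt_trans (by positivity) h1
  rw [div_lt_iff₀ hq] at h1
  rw [lt_div_iff₀ (by linarith)] at h2
  exact ⟨s, α, hs, hα, by linarith, by nlinarith, by nlinarith⟩

/-- Weights refuting a large spectral radius when an edge is missing outside the small side. -/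
theorem exists_weights_of_missing {p t m : ℝ} (hp : 2 ≤ p) (ht : 2 ≤ t)
    (hn : t * (p ^ 2 + 6) ≤ 2 * (m + t)) :
    ∃ σ g α : ℝ, 0 < σ ∧ 0 < g ∧ g < 1 ∧ 0 < α ∧ p * σ < 2 * g ∧ p * σ + (m - 1) * g < 1 ∧
      t * α ≤ m * σ ∧ p * (1 + σ) < (m - t) * α := by
  have h4 : t * (p ^ 2 + 4) ≤ 2 * m := by linarith
  have hp2 : 4 ≤ p ^ 2 := by nlinarith
  have hm : 8 ≤ m := by nlinarith
  have hmt : 0 < m - t := by nlinarith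
  have hm4 : 2 * (t * p) ≤ t * m := by
    have : 2 * p ≤ m := by nlinarith
    nlinarith
  have hc : 0 < m * (m - t) - t * p := by
    have : 3 * t ≤ m - t := by nlinarith
    nlinarith
  -- The lower bound on σ makes the largest admissible α = mσ/t satisfy the last inequality; the
  -- upper bound leaves room for g. The interval is nonempty because the order bound gives tp² ≤ 2m
  -- - 4t.
  obtain ⟨σ, h1, h2⟩ := exists_between
    (show t * p / (m * (m - t) - t * p) < 2 / (p * (m + 1)) by
      rw [div_lt_div_iff₀ hc (by positivity)]
      nlinarith [mul_le_mul_of_nonneg_right h4 (show 0 ≤ m + 1 by linarith),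
        mul_nonneg (sub_nonneg.2 ht) (show 0 ≤ m by linarith)])
  rw [div_lt_iff₀ hc] at h1
  rw [lt_div_iff₀ (by positivity)] at h2
  have hσ : 0 < σ := by
    by_contra! hσ
    nlinarith [mul_nonneg (neg_nonneg.2 hσ) hc.le]
  obtain ⟨g, h3, h5⟩ := exists_between
    (show p * σ / 2 < (1 - p * σ) / (m - 1) by
      rw [div_lt_div_iff₀ (by norm_num) (by linarith)]
      nlinarith)
  rw [lt_div_iff₀ (by linarith)] at h5
  have hps : 0 < p * σ := by positivity
  have hg : 0 < g := by linarith
  refine ⟨σ, g, m * σ / t, hσ, hg, by nlinarith, by positivity, by linarith, by linarith, ?_, ?_⟩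
  · exact (by field_simp : t * (m * σ / t) = m * σ).le
  · rw [mul_div_assoc', lt_div_iff₀ (by linarith)]
    nlinarith

/-! ### Separations from small vertex-connectivity -/

open Finset in
/-- A noncomplete graph of small connectivity splits along a cut of prescribed size. -/
theorem exists_separation {V : Type*} [Fintype V] [DecidableEq V] (G : SimpleGraph V)
    [DecidableRel G.Adj] [Nonempty V] {k : ℕ} (hkδ : k ≤ G.minDegree)
    (hκ : ConnSpec.kappa G < k) :
    ∃ A S : Finset V, Disjoint A S ∧ S.card + 1 = k ∧
      (∀ a ∈ A, ∀ w, G.Adj a w → w ∈ A ∨ w ∈ S) ∧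
      G.minDegree + 2 ≤ A.card + k ∧ 2 * A.card + S.card ≤ Fintype.card V := by
  have hdeg : ∀ A S : Finset V, Disjoint A S → A.Nonempty →
      (∀ a ∈ A, ∀ w, G.Adj a w → w ∈ A ∨ w ∈ S) → G.minDegree + 1 ≤ A.card + S.card := by
    rintro A S hd ⟨a, ha⟩ hA
    have h1 : G.neighborFinset a ⊆ (A ∪ S).erase a := fun w hw => by
      rw [SimpleGraph.mem_neighborFinset] at hw
      exact mem_erase.2 ⟨hw.ne', mem_union.2 (hA a ha w hw)⟩
    have h2 := card_le_card h1
    rw [card_erase_of_mem (mem_union_left _ ha), card_union_of_disjoint hd,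
      SimpleGraph.card_neighborFinset_eq_degree] at h2
    have h3 := G.minDegree_le_degree a
    have : 0 < A.card := card_pos.2 ⟨a, ha⟩
    omega
  obtain ⟨S₀, hcut, hS₀⟩ : ∃ S : Finset V, ConnSpec.IsVertexCut G S ∧ S.card < k := by
    unfold ConnSpec.kappa at hκ
    have hlt : G.minDegree < Fintype.card V := G.minDegree_lt_card
    split_ifs at hκ with h
    · omega
    -- Without a cut the infimum would be the default 0 and would not be attained.
    · have hne : {c : ℕ | ∃ S : Finset V, ConnSpec.IsVertexCut G S ∧ S.card = c}.Nonempty := by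
        obtain ⟨u, v, huv, hadj⟩ := SimpleGraph.ne_top_iff_exists_not_adj.1 h
        refine ⟨_, univ \ {u, v}, fun hpre => ?_, rfl⟩
        obtain ⟨p⟩ := hpre ⟨u, by simp⟩ ⟨v, by simp⟩
        cases p with
        | nil => exact huv rfl
        | @cons _ w _ hw p =>
          have hw' : G.Adj u w := hw
          have := w.2
          simp only [Set.mem_ofPred_eq, mem_sdiff, mem_univ, true_and, not_not, mem_insert,
            mem_singleton] at this
          rcases this with h1 | h1
          · rw [h1] at hw'; exact hw'.ne rfl
          · rw [h1] at hw'; exact hadj hw'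
      obtain ⟨S, h1, h2⟩ := Nat.sInf_mem hne
      exact ⟨S, h1, h2 ▸ hκ⟩
  obtain ⟨A₀, hdA, hAS, hAne, hBne⟩ : ∃ A₀ : Finset V, Disjoint A₀ S₀ ∧
      (∀ a ∈ A₀, ∀ w, G.Adj a w → w ∈ A₀ ∨ w ∈ S₀) ∧ A₀.Nonempty ∧ ((A₀ ∪ S₀)ᶜ).Nonempty := by
    classical
    unfold ConnSpec.IsVertexCut SimpleGraph.Preconnected at hcut
    push Not at hcut
    obtain ⟨⟨u, hu⟩, ⟨v, hv⟩, huv⟩ := hcut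
    refine ⟨univ.filter fun w => ∃ h : w ∉ S₀,
      (G.induce {v : V | v ∉ S₀}).Reachable ⟨u, hu⟩ ⟨w, h⟩, ?_, ?_, ⟨u, ?_⟩, ⟨v, ?_⟩⟩
    · rw [disjoint_left]
      intro w hw
      exact (mem_filter.1 hw).2.1
    · intro a ha w haw
      obtain ⟨h1, h2⟩ := (mem_filter.1 ha).2
      by_cases hw : w ∈ S₀
      · exact Or.inr hw
      · refine Or.inl (mem_filter.2 ⟨mem_univ _, hw, h2.trans ?_⟩)
        exact SimpleGraph.Adj.reachable (by simpa using haw)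
    · exact mem_filter.2 ⟨mem_univ _, hu, SimpleGraph.Reachable.refl _⟩
    · rw [mem_compl, mem_union, mem_filter]
      rintro (⟨-, _, h⟩ | h)
      · exact huv h
      · exact hv h
  have hother : ∀ A S : Finset V, (∀ a ∈ A, ∀ w, G.Adj a w → w ∈ A ∨ w ∈ S) →
      ∀ b ∈ (A ∪ S)ᶜ, ∀ w, G.Adj b w → w ∈ (A ∪ S)ᶜ ∨ w ∈ S := by
    intro A S hA b hb w hbw
    by_cases hw : w ∈ S
    · exact Or.inr hw
    · refine Or.inl (mem_compl.2 fun h => ?_)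
      rcases mem_union.1 h with h | h
      · exact mem_compl.1 hb (mem_union.2 (hA w h b hbw.symm))
      · exact hw h
  have hcompl : ∀ A S : Finset V, Disjoint A S →
      A.card + S.card + ((A ∪ S)ᶜ).card = Fintype.card V := by
    intro A S hd
    rw [← card_union_of_disjoint hd, card_add_card_compl]
  have hdB : ∀ A S : Finset V, Disjoint ((A ∪ S)ᶜ) S := fun A S =>
    disjoint_left.2 fun w hw hS => mem_compl.1 hw (mem_union_right _ hS)
  have horient : ∀ A S : Finset V, Disjoint A S → S.card + 1 = k →
      (∀ a ∈ A, ∀ w, G.Adj a w → w ∈ A ∨ w ∈ S) → A.Nonempty → ((A ∪ S)ᶜ).Nonempty →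
      ∃ A S : Finset V, Disjoint A S ∧ S.card + 1 = k ∧
      (∀ a ∈ A, ∀ w, G.Adj a w → w ∈ A ∨ w ∈ S) ∧
      G.minDegree + 2 ≤ A.card + k ∧ 2 * A.card + S.card ≤ Fintype.card V := by
    intro A S hd hS hA hne hne'
    have h1 := hcompl A S hd
    have h2 := hdeg A S hd hne hA
    have h3 := hdeg _ S (hdB A S) hne' (hother A S hA)
    rcases le_total A.card ((A ∪ S)ᶜ).card with h | h
    · exact ⟨A, S, hd, hS, hA, by omega, by omega⟩
    · exact ⟨_, S, hdB A S, hS, hother A S hA, by omega, by omega⟩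
  have hA₀ := hdeg A₀ S₀ hdA hAne hAS
  -- Moving M from A₀ into the cut brings it to k - 1 vertices; A₀ is not exhausted because |A₀| +
  -- |S₀| > δ ≥ k.
  obtain ⟨M, hMA, hM⟩ := exists_subset_card_eq (show k - 1 - S₀.card ≤ A₀.card by omega)
  refine horient (A₀ \ M) (S₀ ∪ M) ?_ ?_ ?_ ?_ ?_
  · rw [disjoint_left]
    intro w hw hw'
    rw [mem_sdiff] at hw
    rcases mem_union.1 hw' with h | h
    · exact disjoint_left.1 hdA hw.1 h
    · exact hw.2 h
  · rw [card_union_of_disjoint (hdA.symm.mono_right hMA)]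
    omega
  · intro a ha w haw
    rw [mem_sdiff] at ha
    by_cases hw : w ∈ M
    · exact Or.inr (mem_union_right _ hw)
    · rcases hAS a ha.1 w haw with h | h
      · exact Or.inl (mem_sdiff.2 ⟨h, hw⟩)
      · exact Or.inr (mem_union_left _ h)
  · rw [← card_pos, card_sdiff_of_subset hMA]
    omega
  · obtain ⟨b, hb⟩ := hBne
    refine ⟨b, ?_⟩
    simp only [mem_compl, mem_union, mem_sdiff, not_or] at hb ⊢
    exact ⟨fun h => hb.1 h.1, hb.2, fun h => hb.1 (hMA h)⟩

/-! ### Spectral bounds from the weights -/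

-- The weight is constant on each of A, S and the rest, so the worst case has every edge the
-- separation permits and only three row inequalities remain.
open Finset in
theorem rho_lt_of_large_side {V : Type*} [Fintype V] [DecidableEq V] [Nonempty V]
    (G : SimpleGraph V) [DecidableRel G.Adj] {A S : Finset V} (hd : Disjoint A S)
    (hA : ∀ a ∈ A, ∀ w, G.Adj a w → w ∈ A ∨ w ∈ S) {t : ℝ} (ht : 2 ≤ t)
    (hS : 2 ≤ S.card) (hta : t + 1 ≤ A.card) (hAB : 2 * A.card + S.card ≤ Fintype.card V)
    (hn : t * ((S.card : ℝ) ^ 2 + 6) ≤ 2 * Fintype.card V) :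
    ConnSpec.rho G < Fintype.card V - t - 1 := by
  have hcard : (Fintype.card V : ℝ) = A.card + ((A ∪ S)ᶜ).card + S.card := by
    have h := card_add_card_compl (A ∪ S)
    rw [card_union_of_disjoint hd] at h
    rw [← h]; push_cast; ring
  have hAB' : (2 * A.card + S.card : ℝ) ≤ Fintype.card V := by exact_mod_cast hAB
  rw [hcard] at hAB' hn ⊢
  obtain ⟨s, α, hs, hα, hB, hSS, hAA⟩ := exists_weights_of_lt (p := S.card)
    (a := A.card) (b := ((A ∪ S)ᶜ).card) (by exact_mod_cast hS) ht hta (by linarith) hn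
  set x : V → ℝ := fun w => if w ∈ A then α else if w ∈ S then s else 1 with hxdef
  have hx : ∀ w, 0 < x w := fun w => by simp only [hxdef]; split_ifs <;> positivity
  have xA : ∀ w ∈ A, x w = α := fun w hw => by simp [hxdef, hw]
  have xS : ∀ w ∈ S, x w = s := fun w hw => by
    simp [hxdef, hw, disjoint_right.1 hd hw]
  have xB : ∀ w ∈ (A ∪ S)ᶜ, x w = 1 := fun w hw => by
    simp only [mem_compl, mem_union, not_or] at hw
    simp [hxdef, hw]
  have sA : ∑ w ∈ A, x w = A.card * α := by rw [sum_congr rfl xA]; simp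
  have sS : ∑ w ∈ S, x w = S.card * s := by rw [sum_congr rfl xS]; simp
  have sB : ∑ w ∈ (A ∪ S)ᶜ, x w = ((A ∪ S)ᶜ).card := by rw [sum_congr rfl xB]; simp
  have bound : ∀ (v : V) (T : Finset V), v ∈ T → (∀ w, G.Adj v w → w ∈ T) →
      ∑ w ∈ G.neighborFinset v, x w ≤ ∑ w ∈ T, x w - x v := by
    intro v T hv hT
    rw [le_sub_iff_add_le, ← sum_erase_add _ _ hv]
    refine add_le_add_left (sum_le_sum_of_subset_of_nonneg (fun w hw => ?_) fun w _ _ => (hx w).le) _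
    rw [SimpleGraph.mem_neighborFinset] at hw
    exact mem_erase.2 ⟨hw.ne', hT w hw⟩
  refine rho_lt_of_weights G x _ hx fun v => ?_
  by_cases hvA : v ∈ A
  · refine (bound v (A ∪ S) (mem_union_left _ hvA) fun w hw =>
      mem_union.2 (hA v hvA w hw)).trans_lt ?_
    rw [sum_union hd, sA, sS, xA v hvA]
    linarith
  by_cases hvS : v ∈ S
  · refine (bound v univ (mem_univ _) fun w _ => mem_univ w).trans_lt ?_
    rw [← sum_add_sum_compl (A ∪ S), sum_union hd, sA, sS, sB, xS v hvS]
    linarith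
  · have hvB : v ∈ (A ∪ S)ᶜ := by simp [hvA, hvS]
    have hdB : Disjoint S ((A ∪ S)ᶜ) :=
      disjoint_left.2 fun w hw h => mem_compl.1 h (mem_union_right _ hw)
    refine (bound v (S ∪ (A ∪ S)ᶜ) (mem_union_right _ hvB) fun w hw => ?_).trans_lt ?_
    · by_contra h
      simp only [mem_union, mem_compl, not_or (p := _ ∈ S), not_not] at h
      rcases h.2 with hwA | hwS
      · rcases hA w hwA v hw.symm with h' | h'
        · exact hvA h'
        · exact hvS h'
      · exact h.1 hwS
    · rw [sum_union hdB, sS, sB, xB v hvB]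
      linarith

-- A clique on the complement of A has spectral radius |Aᶜ| - 1, with constant eigenvector. Lowering
-- the weight by g at u and v leaves slack for raising it by σ on S, which in turn pays for the
-- edges to A. At u and v themselves the slack comes from the missing edge.
open Finset in
theorem rho_lt_of_missing_edge {V : Type*} [Fintype V] [DecidableEq V] [Nonempty V]
    (G : SimpleGraph V) [DecidableRel G.Adj] {A S : Finset V} (hd : Disjoint A S)
    (hA : ∀ a ∈ A, ∀ w, G.Adj a w → w ∈ A ∨ w ∈ S) (ht : 2 ≤ A.card) (hS : 2 ≤ S.card)
    (hn : (A.card : ℝ) * ((S.card : ℝ) ^ 2 + 6) ≤ 2 * Fintype.card V)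
    {u v : V} (hu : u ∉ A) (hv : v ∉ A) (huv : u ≠ v) (hadj : ¬ G.Adj u v) :
    ConnSpec.rho G < Fintype.card V - A.card - 1 := by
  have hcard : (Fintype.card V : ℝ) = (Aᶜ).card + A.card := by
    rw [← card_add_card_compl A]; push_cast; ring
  rw [hcard] at hn ⊢
  obtain ⟨σ, g, α, hσ, hg, hg1, hα, h1, h2, h3, h4⟩ := exists_weights_of_missing
    (p := S.card) (t := A.card) (m := (Aᶜ).card) (by exact_mod_cast hS) (by exact_mod_cast ht) hn
  have hSA : S ⊆ Aᶜ := fun w hw => mem_compl.2 (disjoint_right.1 hd hw)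
  set y : V → ℝ := fun w =>
    1 + (if w ∈ S then σ else 0) - ((if w = u then g else 0) + if w = v then g else 0) with hydef
  set x : V → ℝ := fun w => if w ∈ A then α else y w with hxdef
  have hy : ∀ w, 0 < y w := fun w => by
    simp only [hydef]
    rcases eq_or_ne w u with rfl | h
    · rw [if_neg huv]; split_ifs <;> simp <;> linarith
    · rw [if_neg h]; split_ifs <;> linarith
  have hx : ∀ w, 0 < x w := fun w => by
    simp only [hxdef]; split_ifs
    · exact hα
    · exact hy w
  have xA : ∀ w ∈ A, x w = α := fun w hw => by simp [hxdef, hw]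
  have xB : ∀ w, w ∉ A → x w = y w := fun w hw => by simp [hxdef, hw]
  have sA : ∑ w ∈ A, x w = A.card * α := by rw [sum_congr rfl xA]; simp
  have sD : ∑ w ∈ Aᶜ, x w = (Aᶜ).card + S.card * σ - 2 * g := by
    rw [sum_congr rfl fun w hw => xB w (mem_compl.1 hw)]
    simp only [hydef, sum_sub_distrib, sum_add_distrib, sum_ite_eq', sum_ite_mem,
      inter_eq_right.2 hSA, mem_compl, hu, hv, not_false_eq_true, if_true, sum_const,
      nsmul_eq_mul]
    ring
  have sS : ∑ w ∈ S, x w ≤ S.card * (1 + σ) := by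
    rw [← nsmul_eq_mul]
    refine sum_le_card_nsmul _ _ _ fun w hw => ?_
    rw [xB w (disjoint_right.1 hd hw)]
    simp only [hydef, hw, if_true]
    split_ifs <;> linarith
  have bound : ∀ (w : V) (T : Finset V), (∀ z, G.Adj w z → z ∈ T) →
      ∑ z ∈ G.neighborFinset w, x z ≤ ∑ z ∈ T, x z := by
    intro w T hT
    refine sum_le_sum_of_subset_of_nonneg (fun z hz => ?_) fun z _ _ => (hx z).le
    exact hT z ((SimpleGraph.mem_neighborFinset _ _ _).1 hz)
  have bound_end : ∀ u' v' : V, u' ∉ A → v' ∉ A → u' ≠ v' → ¬ G.Adj u' v' →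
      y u' = 1 + (if u' ∈ S then σ else 0) - g → y v' = 1 + (if v' ∈ S then σ else 0) - g →
      ∑ z ∈ G.neighborFinset u', x z < ((Aᶜ).card + A.card - A.card - 1) * x u' := by
    intro u' v' hu' hv' hne hna e1 e2
    have hsplit : ∑ z ∈ (Aᶜ.erase u').erase v', x z = ∑ z ∈ Aᶜ, x z - y u' - y v' := by
      rw [← sum_erase_add _ _ (mem_compl.2 hu'),
        ← sum_erase_add (Aᶜ.erase u') _ (mem_erase.2 ⟨hne.symm, mem_compl.2 hv'⟩),
        xB _ hu', xB _ hv']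
      ring
    have hyv : 1 - g ≤ y v' := by rw [e2]; split_ifs <;> linarith
    rw [xB _ hu']
    by_cases hS' : u' ∈ S
    · rw [if_pos hS'] at e1
      refine (bound u' (A ∪ (Aᶜ.erase u').erase v') fun z hz => ?_).trans_lt ?_
      · by_cases hzA : z ∈ A
        · exact mem_union_left _ hzA
        · refine mem_union_right _ (mem_erase.2 ⟨?_, mem_erase.2 ⟨hz.ne', mem_compl.2 hzA⟩⟩)
          rintro rfl; exact hna hz
      · rw [sum_union, sA, hsplit, sD, e1]
        · nlinarith
        · exact disjoint_left.2 fun z hz hz' =>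
            mem_compl.1 (mem_erase.1 (mem_erase.1 hz').2).2 hz
    · rw [if_neg hS'] at e1
      refine (bound u' ((Aᶜ.erase u').erase v') fun z hz => ?_).trans_lt ?_
      · refine mem_erase.2 ⟨?_, mem_erase.2 ⟨hz.ne', mem_compl.2 fun hzA => ?_⟩⟩
        · rintro rfl; exact hna hz
        · rcases hA z hzA u' hz.symm with h | h
          · exact hu' h
          · exact hS' h
      · rw [hsplit, sD, e1]
        nlinarith
  refine rho_lt_of_weights G x _ hx fun w => ?_
  by_cases hwA : w ∈ A
  · have hsplit : ∑ z ∈ A.erase w, x z = A.card * α - α := by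
      rw [← sA, ← sum_erase_add _ _ hwA, xA w hwA]; ring
    refine (bound w (A.erase w ∪ S) fun z hz => ?_).trans_lt ?_
    · rcases hA w hwA z hz with h | h
      · exact mem_union_left _ (mem_erase.2 ⟨hz.ne', h⟩)
      · exact mem_union_right _ h
    · rw [sum_union (hd.mono_left (erase_subset _ _)), hsplit, xA w hwA]
      nlinarith
  rcases eq_or_ne w u with rfl | hwu
  · exact bound_end w v hwA hv huv hadj (by simp [hydef, huv]) (by simp [hydef, huv.symm])
  rcases eq_or_ne w v with rfl | hwv
  · exact bound_end w u hwA hu huv.symm (fun h => hadj h.symm) (by simp [hydef, huv.symm])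
      (by simp [hydef, huv])
  have hyw : y w = 1 + if w ∈ S then σ else 0 := by simp [hydef, hwu, hwv]
  have hsplit : ∑ z ∈ Aᶜ.erase w, x z = ∑ z ∈ Aᶜ, x z - y w := by
    rw [← sum_erase_add _ _ (mem_compl.2 hwA), xB _ hwA]; ring
  rw [xB _ hwA]
  by_cases hwS : w ∈ S
  · rw [if_pos hwS] at hyw
    refine (bound w (A ∪ Aᶜ.erase w) fun z hz => ?_).trans_lt ?_
    · by_cases hzA : z ∈ A
      · exact mem_union_left _ hzA
      · exact mem_union_right _ (mem_erase.2 ⟨hz.ne', mem_compl.2 hzA⟩)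
    · rw [sum_union, sA, hsplit, sD, hyw]
      · nlinarith
      · exact disjoint_left.2 fun z hz hz' => mem_compl.1 (mem_erase.1 hz').2 hz
  · rw [if_neg hwS] at hyw
    refine (bound w (Aᶜ.erase w) fun z hz => ?_).trans_lt ?_
    · refine mem_erase.2 ⟨hz.ne', mem_compl.2 fun hzA => ?_⟩
      rcases hA z hzA w hz.symm with h | h
      · exact hwA h
      · exact hwS h
    · rw [hsplit, sD, hyw]
      nlinarith

/-! ### The exceptional graph and the conclusion -/

open Finset in
/-- A graph whose only nonadjacent pairs separate `A` from the complement of `A ∪ S`. -/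
theorem nonempty_iso_joinOfCompletes {V : Type*} [Fintype V] [DecidableEq V] (G : SimpleGraph V)
    {A S : Finset V} (hd : Disjoint A S) {p a b : ℕ} (hS : S.card = p) (hA : A.card = a)
    (hB : ((A ∪ S)ᶜ).card = b)
    (hadj : ∀ u v, G.Adj u v ↔ u ≠ v ∧ ¬ (u ∈ A ∧ v ∈ (A ∪ S)ᶜ) ∧ ¬ (v ∈ A ∧ u ∈ (A ∪ S)ᶜ)) :
    Nonempty (G ≃g ConnSpec.joinOfCompletes p a b) := by
  let eS := S.equivFinOfCardEq hS
  let eA := A.equivFinOfCardEq hA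
  let eB := ((A ∪ S)ᶜ).equivFinOfCardEq hB
  let F : Fin p ⊕ (Fin a ⊕ Fin b) → V :=
    Sum.elim (fun i => (eS.symm i : V))
      (Sum.elim (fun i => (eA.symm i : V)) (fun i => (eB.symm i : V)))
  have mS : ∀ i, (eS.symm i : V) ∈ S := fun i => (eS.symm i).2
  have mA : ∀ i, (eA.symm i : V) ∈ A := fun i => (eA.symm i).2
  have mB : ∀ i, (eB.symm i : V) ∈ (A ∪ S)ᶜ := fun i => (eB.symm i).2
  have nSA : ∀ i, (eS.symm i : V) ∉ A := fun i => disjoint_right.1 hd (mS i)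
  have nBA : ∀ i, (eB.symm i : V) ∉ A := fun i h => mem_compl.1 (mB i) (mem_union_left _ h)
  have nBS : ∀ i, (eB.symm i : V) ∉ S := fun i h => mem_compl.1 (mB i) (mem_union_right _ h)
  have nSB : ∀ i j, (eS.symm i : V) ≠ eB.symm j := fun i j h => nBS j (h ▸ mS i)
  have nAB : ∀ i j, (eA.symm i : V) ≠ eB.symm j := fun i j h => nBA j (h ▸ mA i)
  have nSA' : ∀ i j, (eS.symm i : V) ≠ eA.symm j := fun i j h => nSA i (h ▸ mA j)
  have hinj : Function.Injective F := by
    rintro (i | i | i) (j | j | j) h <;>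
      simp only [F, Sum.elim_inl, Sum.elim_inr] at h
    · rw [eS.symm.injective (Subtype.ext h)]
    · exact absurd h (nSA' i j)
    · exact absurd h (nSB i j)
    · exact absurd h.symm (nSA' j i)
    · rw [eA.symm.injective (Subtype.ext h)]
    · exact absurd h (nAB i j)
    · exact absurd h.symm (nSB j i)
    · exact absurd h.symm (nAB j i)
    · rw [eB.symm.injective (Subtype.ext h)]
  have hsurj : Function.Surjective F := by
    intro w
    by_cases hw : w ∈ A
    · exact ⟨.inr (.inl (eA ⟨w, hw⟩)), by simp [F]⟩
    by_cases hw' : w ∈ S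
    · exact ⟨.inl (eS ⟨w, hw'⟩), by simp [F]⟩
    · exact ⟨.inr (.inr (eB ⟨w, by simp [hw, hw']⟩)), by simp [F]⟩
  have hbij : Function.Bijective F := ⟨hinj, hsurj⟩
  refine ⟨RelIso.symm ⟨Equiv.ofBijective F hbij, ?_⟩⟩
  rintro x y
  change G.Adj (F x) (F y) ↔ _
  rw [hadj, hinj.ne_iff]
  rcases x with (i | i | i) <;> rcases y with (j | j | j) <;>
    simp [F, ConnSpec.joinOfCompletes, ConnSpec.join, nSA, nBA, nBS, mA, mS]

theorem theorem2p5 {V : Type*} [Fintype V] [DecidableEq V] (G : SimpleGraph V)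
    [DecidableRel G.Adj] (hconn : G.Connected)
    (n δ k : ℕ) (hn : n = Fintype.card V) (hδ : δ = G.minDegree)
    (hk : 3 ≤ k) (hkδ : k ≤ δ)
    (horder : (1 / 2 : ℝ) * ((δ : ℝ) - k + 2) * ((k : ℝ) ^ 2 - 2 * k + 7) ≤ (n : ℝ))
    (hrho : (n : ℝ) - δ + k - 3 ≤ ConnSpec.rho G) :
    k ≤ ConnSpec.kappa G ∨
      Nonempty (G ≃g ConnSpec.joinOfCompletes (k - 1) (δ - k + 2) (n - δ - 1)) := by
  have := hconn.nonempty
  refine or_iff_not_imp_left.2 fun hκ => ?_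
  subst hn hδ
  have hk' : (3 : ℝ) ≤ k := by exact_mod_cast hk
  have hkδ' : (k : ℝ) ≤ G.minDegree := by exact_mod_cast hkδ
  obtain ⟨A, S, hd, hS, hA, hAl, hAu⟩ :=
    exists_separation G hkδ (not_le.1 hκ)
  have hSr : (S.card : ℝ) = k - 1 := by rw [← hS]; push_cast; ring
  have hn' : ((G.minDegree : ℝ) - k + 2) * ((S.card : ℝ) ^ 2 + 6) ≤ 2 * Fintype.card V := by
    rw [hSr]; nlinarith
  have hAr : (G.minDegree + 2 : ℝ) ≤ A.card + k := by exact_mod_cast hAl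
  rcases hAl.lt_or_eq with hlt | heq
  · have hlt' : (G.minDegree + 2 + 1 : ℝ) ≤ A.card + k := by exact_mod_cast hlt
    have := rho_lt_of_large_side G hd hA (t := (G.minDegree : ℝ) - k + 2) (by linarith)
      (by omega) (by linarith) hAu hn'
    linarith
  · have heq' : (A.card : ℝ) = G.minDegree - k + 2 := by
      have : (G.minDegree + 2 : ℝ) = A.card + k := by exact_mod_cast heq
      linarith
    have hclique : ∀ u v, u ∉ A → v ∉ A → u ≠ v → G.Adj u v := by
      intro u v hu hv huv
      by_contra hna
      have := rho_lt_of_missing_edge G hd hA (by omega) (by omega) (by rw [heq']; exact hn')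
        hu hv huv hna
      linarith
    have hfull : ∀ u ∈ A, ∀ v, v ∈ A ∨ v ∈ S → u ≠ v → G.Adj u v := by
      intro u hu v hv huv
      have h1 : G.neighborFinset u ⊆ (A ∪ S).erase u := fun w hw => by
        rw [SimpleGraph.mem_neighborFinset] at hw
        exact Finset.mem_erase.2 ⟨hw.ne', Finset.mem_union.2 (hA u hu w hw)⟩
      -- Here |A| + |S| - 1 = δ, so the minimum degree leaves no room for a missing neighbour.
      have h2 := Finset.eq_of_subset_of_card_le h1 (by
        rw [Finset.card_erase_of_mem (Finset.mem_union_left _ hu),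
          Finset.card_union_of_disjoint hd, SimpleGraph.card_neighborFinset_eq_degree]
        have := G.minDegree_le_degree u
        omega)
      rw [← SimpleGraph.mem_neighborFinset, h2]
      exact Finset.mem_erase.2 ⟨huv.symm, Finset.mem_union.2 hv⟩
    have hB := Finset.card_add_card_compl (A ∪ S)
    rw [Finset.card_union_of_disjoint hd] at hB
    refine nonempty_iso_joinOfCompletes G hd (by omega) (by omega) (by omega) fun u v => ?_
    simp only [Finset.mem_compl, Finset.mem_union, not_or, not_and_or, not_not]
    constructor
    · intro h
      refine ⟨h.ne, ?_, ?_⟩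
      · by_cases hu : u ∈ A
        · exact Or.inr (hA u hu v h)
        · exact Or.inl hu
      · by_cases hv : v ∈ A
        · exact Or.inr (hA v hv u h.symm)
        · exact Or.inl hv
    · rintro ⟨hne, h1, h2⟩
      by_cases hu : u ∈ A
      · exact hfull u hu v (h1.resolve_left (not_not.2 hu)) hne
      by_cases hv : v ∈ A
      · exact (hfull v hv u (h2.resolve_left (not_not.2 hv)) hne.symm).symm
      · exact hclique u v hu hv hne
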